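/- Let $N\ge 1$, let $\Omega\subset\mathbb R^N$ be a bounded domain, $p\in(1,\infty)$ and $\frac1p+\frac1q=1$. Let $W^{1,p}_0(\Omega)$ be the closure of $C_c^\infty(\Omega)$ in $W^{1,p}(\Omega)$ and $W^{-1,q}(\Omega)$ its dual. For $u\in W^{1,p}_0(\Omega)$ put $$I(u)=\int_\Omega|\nabla u|^p\,dx,\qquad J(u)=\int_\Omega|u|^p\,dx,\qquad S=\{u\in W^{1,p}_0(\Omega)\mid J(u)=1\},$$ with Fréchet derivatives $I'(u),J'(u)\in W^{-1,q}(\Omega)$. Call $u\in S$ a critical point of $I$ with respect to $S$ if $\langle I'(u),h\rangle=0$ for every $h\in T_uS=\{h\in W^{1,p}_0(\Omega)\mid\langle J'(u),h\rangle=0\}$. Let $-\Delta_p:W^{1,p}_0(\Omega)\to W^{-1,q}(\Omega)$ be given by $\langle-\Delta_p v,\varphi\rangle=\int_\Omega|\nabla v|^{p-2}\nabla v\cdot\nabla\varphi\,dx$, and regard $|u|^{p-2}u$ as the element $\varphi\mapsto\int_\Omega|u|^{p-2}u\,\varphi\,dx$ of $W^{-1,q}(\Omega)$. Let $u\in S$.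 Then $I$ and $J$ are Fréchet differentiable at $u$, the equation $-\Delta_p v=|u|^{p-2}u$ has a unique solution $v_u=(-\Delta_p)^{-1}(|u|^{p-2}u)$ in $W^{1,p}_0(\Omega)$, and $\int_\Omega|u|^{p-2}u\,v_u\,dx>0$, so that $$w_u:=-u+\frac{1}{\int_\Omega|u|^{p-2}u\,v_u\,dx}\,v_u$$ is well defined. Moreover $\langle I'(u),w_u\rangle\le 0$; equality holds if and only if $u$ is a critical point of $I$ with respect to $S$, which is the case if and only if $w_u=0$. -/

import Mathlib

open MeasureTheory Set
open scoped ContDiff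

noncomputable section

namespace PLap

/-! ### Exponents and underlying spaces -/

instance fact_one_le_ofReal (p : ℝ) [hp : Fact (1 < p)] : Fact ((1 : ENNReal) ≤ ENNReal.ofReal p) :=
  ⟨by simpa using ENNReal.ofReal_le_ofReal hp.out.le⟩

/-- The Euclidean space `ℝ^N`. -/
abbrev E (N : ℕ) : Type := EuclideanSpace ℝ (Fin N)

/-- `L^p(Ω)`, real-valued functions. -/
abbrev LpFun {N : ℕ} (Ω : Set (E N)) (p : ℝ) : Type :=
  Lp ℝ (ENNReal.ofReal p) (volume.restrict Ω)

/-- `L^p(Ω; ℝ^N)`, vector fields. -/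
abbrev LpVec {N : ℕ} (Ω : Set (E N)) (p : ℝ) : Type :=
  Lp (E N) (ENNReal.ofReal p) (volume.restrict Ω)

/-- `φ ∈ C_c^∞(Ω)`. -/
structure IsTest {N : ℕ} (Ω : Set (E N)) (φ : E N → ℝ) : Prop where
  smooth : ContDiff ℝ ∞ φ
  compact : HasCompactSupport φ
  supp : tsupport φ ⊆ Ω

/-- The linear space of all pairs `(φ, ∇φ)` with `φ ∈ C_c^∞(Ω)`, inside
`L^p(Ω) × L^p(Ω; ℝ^N)`. -/
def testPairs {N : ℕ} (Ω : Set (E N)) (p : ℝ) [Fact (1 < p)] :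
    Submodule ℝ (LpFun Ω p × LpVec Ω p) where
  carrier := {z | ∃ φ : E N → ℝ, IsTest Ω φ ∧
    z.1 =ᵐ[volume.restrict Ω] φ ∧ z.2 =ᵐ[volume.restrict Ω] gradient φ}
  zero_mem' := by
    refine ⟨0, ⟨contDiff_const, HasCompactSupport.zero, ?_⟩, Lp.coeFn_zero .., ?_⟩
    · rw [tsupport_eq_empty_iff.2 rfl]; exact empty_subset _
    · filter_upwards [Lp.coeFn_zero (E N) (ENNReal.ofReal p) (volume.restrict Ω)] with x hx
      change ((0 : LpVec Ω p) : E N → E N) x = _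
      rw [hx]; exact (congrFun (gradient_const' (0 : ℝ)) x).symm
  add_mem' := by
    rintro a b ⟨φ, hφ, ha1, ha2⟩ ⟨ψ, hψ, hb1, hb2⟩
    refine ⟨φ + ψ, ⟨hφ.smooth.add hψ.smooth, hφ.compact.add hψ.compact,
      (tsupport_add φ ψ).trans (union_subset hφ.supp hψ.supp)⟩, ?_, ?_⟩
    · exact (Lp.coeFn_add a.1 b.1).trans (ha1.add hb1)
    · filter_upwards [Lp.coeFn_add a.2 b.2, ha2, hb2] with x hx h1 h2
      have hd := hφ.smooth.differentiable (by simp) x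
      have hd' := hψ.smooth.differentiable (by simp) x
      change (a.2 + b.2 : LpVec Ω p) x = _
      rw [hx, Pi.add_apply, h1, h2]
      simp only [gradient]
      rw [fderiv_add hd hd', map_add]
  smul_mem' := by
    rintro c a ⟨φ, hφ, ha1, ha2⟩
    refine ⟨c • φ, ⟨hφ.smooth.const_smul c, hφ.compact.smul_left (f := fun _ => c),
      (closure_mono (Function.support_const_smul_subset c φ)).trans hφ.supp⟩, ?_, ?_⟩
    · filter_upwards [Lp.coeFn_smul c a.1, ha1] with x hx h1
      change (c • a.1 : LpFun Ω p) x = _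
      rw [hx, Pi.smul_apply, h1, Pi.smul_apply]
    · filter_upwards [Lp.coeFn_smul c a.2, ha2] with x hx h1
      have hd := hφ.smooth.differentiable (by simp) x
      change (c • a.2 : LpVec Ω p) x = _
      rw [hx, Pi.smul_apply, h1]
      simp only [gradient]
      rw [fderiv_const_smul hd, map_smulₛₗ]
      simp

/-- The Sobolev space `W^{1,p}_0(Ω)`: the closure of `C_c^∞(Ω)` in the `W^{1,p}` norm.
A Sobolev function `u` is represented by the pair `(u, ∇u)`; by `isWeakGradient` and `ext_val`
below the second component is the weak gradient of the first one and is determined by it.  The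
norm is the (equivalent) `W^{1,p}` norm `max (‖u‖_{L^p}) (‖∇u‖_{L^p})`. -/
def W0 {N : ℕ} (Ω : Set (E N)) (p : ℝ) [Fact (1 < p)] :
    Submodule ℝ (LpFun Ω p × LpVec Ω p) :=
  (testPairs Ω p).topologicalClosure

section Space

variable {N : ℕ} {Ω : Set (E N)} {p : ℝ} [Fact (1 < p)]

/-- The function `u ∈ L^p(Ω)` underlying an element of `W^{1,p}_0(Ω)`. -/
def val : W0 Ω p →L[ℝ] LpFun Ω p :=
  (ContinuousLinearMap.fst ℝ (LpFun Ω p) (LpVec Ω p)).comp (W0 Ω p).subtypeL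

/-- The weak gradient `∇u ∈ L^p(Ω; ℝ^N)` of an element of `W^{1,p}_0(Ω)`. -/
def grad : W0 Ω p →L[ℝ] LpVec Ω p :=
  (ContinuousLinearMap.snd ℝ (LpFun Ω p) (LpVec Ω p)).comp (W0 Ω p).subtypeL

end Space

/-! ### The duality pairing `∫ |f|^{p-2} f · g` -/

section Pairing

variable {N : ℕ} {p : ℝ}
  {H : Type*} [NormedAddCommGroup H] {μ : Measure (E N)}

theorem norm_integrand_le [InnerProductSpace ℝ H] (a b : H) :
    ‖‖a‖ ^ (p - 2) * inner ℝ a b‖ ≤ ‖‖a‖ ^ (p - 1)‖ * ‖b‖ := by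
  rcases eq_or_ne a 0 with rfl | ha
  · simp only [inner_zero_left, mul_zero, norm_zero]; positivity
  have h0 : 0 < ‖a‖ := norm_pos_iff.2 ha
  rw [norm_mul, Real.norm_of_nonneg (by positivity : 0 ≤ ‖a‖ ^ (p - 2)),
    Real.norm_of_nonneg (by positivity : 0 ≤ ‖a‖ ^ (p - 1))]
  calc ‖a‖ ^ (p - 2) * ‖inner ℝ a b‖ ≤ ‖a‖ ^ (p - 2) * (‖a‖ * ‖b‖) := by
        gcongr; exact norm_inner_le_norm a b
    _ = ‖a‖ ^ (p - 1) * ‖b‖ := by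
        rw [← mul_assoc, ← Real.rpow_add_one h0.ne']; ring_nf

theorem memLp_norm_rpow_sub_one [hp : Fact (1 < p)] (f : Lp H (ENNReal.ofReal p) μ) :
    MemLp (fun x => ‖f x‖ ^ (p - 1)) (ENNReal.ofReal p.conjExponent) μ := by
  have hp0 : 0 < p - 1 := sub_pos.2 hp.out
  have h := (Lp.memLp f).norm_rpow_div (ENNReal.ofReal (p - 1))
  rwa [ENNReal.toReal_ofReal hp0.le, ← ENNReal.ofReal_div_of_pos hp0] at h

variable [hp : Fact (1 < p)] [InnerProductSpace ℝ H]

theorem integrable_integrand (f g : Lp H (ENNReal.ofReal p) μ) :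
    Integrable (fun x => ‖f x‖ ^ (p - 2) * inner ℝ (f x) (g x)) μ := by
  have hf := (Lp.memLp f).1
  have hg := (Lp.memLp g).1
  have hc : p.HolderConjugate p.conjExponent := .conjExponent hp.out
  have : ENNReal.HolderConjugate (ENNReal.ofReal p.conjExponent) (ENNReal.ofReal p) :=
    hc.symm.ennrealOfReal
  have hi : Integrable (fun x => ‖‖f x‖ ^ (p - 1)‖ * ‖g x‖) μ :=
    MemLp.integrable_mul (memLp_norm_rpow_sub_one f).norm (Lp.memLp g).norm
  refine hi.mono' ?_ (.of_forall fun x => norm_integrand_le _ _)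
  exact (hf.norm.aemeasurable.pow_const _).aestronglyMeasurable.mul (hf.inner hg)

/-- For `f ∈ L^p`, the bounded linear functional `g ↦ ∫ |f|^{p-2} f · g` on `L^p`. -/
def pairing (f : Lp H (ENNReal.ofReal p) μ) : Lp H (ENNReal.ofReal p) μ →L[ℝ] ℝ :=
  LinearMap.mkContinuousOfExistsBound
    { toFun := fun g => ∫ x, ‖f x‖ ^ (p - 2) * inner ℝ (f x) (g x) ∂μ
      map_add' := fun g h => by
        rw [← integral_add (integrable_integrand f g) (integrable_integrand f h)]
        refine integral_congr_ae ?_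
        filter_upwards [Lp.coeFn_add g h] with x hx
        rw [hx, Pi.add_apply, inner_add_right, mul_add]
      map_smul' := fun c g => by
        rw [RingHom.id_apply, smul_eq_mul, ← integral_const_mul]
        refine integral_congr_ae ?_
        filter_upwards [Lp.coeFn_smul c g] with x hx
        rw [hx, Pi.smul_apply, inner_smul_right]
        ring }
    (by
      have hc : p.HolderConjugate p.conjExponent := .conjExponent hp.out
      have hp0 : 0 < p := one_pos.trans hp.out
      refine ⟨(∫ x, ‖‖f x‖ ^ (p - 1)‖ ^ p.conjExponent ∂μ) ^ (1 / p.conjExponent), fun g => ?_⟩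
      have hn : ‖g‖ = (∫ x, ‖g x‖ ^ p ∂μ) ^ (1 / p) := by
        rw [Lp.norm_def, (Lp.memLp g).eLpNorm_eq_integral_rpow_norm (by simpa using hp0) (by simp),
          ENNReal.toReal_ofReal hp0.le, ENNReal.toReal_ofReal (by positivity), one_div]
      have : ENNReal.HolderConjugate (ENNReal.ofReal p.conjExponent) (ENNReal.ofReal p) :=
        hc.symm.ennrealOfReal
      have hi : Integrable (fun x => ‖‖f x‖ ^ (p - 1)‖ * ‖g x‖) μ :=
        MemLp.integrable_mul (memLp_norm_rpow_sub_one f).norm (Lp.memLp g).norm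
      have hh := integral_mul_norm_le_Lp_mul_Lq hc.symm (memLp_norm_rpow_sub_one f)
        (Lp.memLp g).norm
      simp only [norm_norm (g _)] at hh
      rw [hn]
      exact (norm_integral_le_of_norm_le hi (.of_forall fun x => norm_integrand_le _ _)).trans
        hh)

theorem pairing_apply (f g : Lp H (ENNReal.ofReal p) μ) :
    pairing f g = ∫ x, ‖f x‖ ^ (p - 2) * inner ℝ (f x) (g x) ∂μ := rfl

end Pairing

/-! ### The functionals, the constraint and the descent direction -/

section Main

variable {N : ℕ} {Ω : Set (E N)} {p : ℝ} [Fact (1 < p)]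

/-- `I(u) = ∫_Ω |∇u|^p dx`. -/
def I (u : W0 Ω p) : ℝ := ∫ x in Ω, ‖grad u x‖ ^ p

/-- `J(u) = ∫_Ω |u|^p dx`. -/
def J (u : W0 Ω p) : ℝ := ∫ x in Ω, |val u x| ^ p

/-- The constraint set `S = {u ∈ W^{1,p}_0(Ω) | J(u) = 1}`. -/
def S (Ω : Set (E N)) (p : ℝ) [Fact (1 < p)] : Set (W0 Ω p) := {u | J u = 1}

/-- The tangent space `T_u S = {h | ⟨J'(u), h⟩ = 0}`, with `J'(u)` the Fréchet derivative. -/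
def tangentSpaceS (u : W0 Ω p) : Submodule ℝ (W0 Ω p) := LinearMap.ker (fderiv ℝ J u).toLinearMap

/-- `u` is a critical point of `I` with respect to `S`: `u ∈ S` and `I'(u)` vanishes on the
tangent space `T_u S`. -/
def IsCriticalOnS (u : W0 Ω p) : Prop :=
  u ∈ S Ω p ∧ ∀ h ∈ tangentSpaceS u, fderiv ℝ I u h = 0

/-- The operator `-Δ_p : W^{1,p}_0(Ω) → W^{-1,q}(Ω)`, with values in the topological dual:
`⟨-Δ_p u, φ⟩ = ∫_Ω |∇u|^{p-2} ∇u · ∇φ dx`. -/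
def negPLaplacian (u : W0 Ω p) : W0 Ω p →L[ℝ] ℝ := (pairing (grad u)).comp grad

/-- The function `|u|^{p-2} u` as an element of `W^{-1,q}(Ω)`:
`φ ↦ ∫_Ω |u|^{p-2} u φ dx`. -/
def powFunctional (u : W0 Ω p) : W0 Ω p →L[ℝ] ℝ := (pairing (val u)).comp val

theorem negPLaplacian_apply (u φ : W0 Ω p) :
    negPLaplacian u φ = ∫ x in Ω, ‖grad u x‖ ^ (p - 2) * inner ℝ (grad u x) (grad φ x) := rfl

theorem powFunctional_apply (u φ : W0 Ω p) :
    powFunctional u φ = ∫ x in Ω, |val u x| ^ (p - 2) * val u x * val φ x := by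
  change ∫ x in Ω, ‖val u x‖ ^ (p - 2) * inner ℝ (val u x) (val φ x) = _
  simp only [Real.norm_eq_abs, RCLike.inner_apply, conj_trivial]
  congr 1; ext x; ring

/-- The inverse operator `(-Δ_p)^{-1} : W^{-1,q}(Ω) → W^{1,p}_0(Ω)`. -/
def invNegPLaplacian : (W0 Ω p →L[ℝ] ℝ) → W0 Ω p := Function.invFun negPLaplacian

/-- `v_u = (-Δ_p)^{-1} (|u|^{p-2} u)`. -/
def vdir (u : W0 Ω p) : W0 Ω p := invNegPLaplacian (powFunctional u)

/-- `w_u = -u + (1 / ∫_Ω |u|^{p-2} u v_u dx) v_u`. -/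
def wdir (u : W0 Ω p) : W0 Ω p :=
  -u + (1 / ∫ x in Ω, |val u x| ^ (p - 2) * val u x * val (vdir u) x) • vdir u

end Main

/-! ### The pair encoding of `W^{1,p}_0(Ω)` is faithful -/

section Faithful

variable {N : ℕ} {Ω : Set (E N)} {p : ℝ} [Fact (1 < p)]

/-- `G` is the weak gradient of `u` in `Ω`. -/
def IsWeakGradient (Ω : Set (E N)) (u : E N → ℝ) (G : E N → E N) : Prop :=
  ∀ ψ : E N → ℝ, IsTest Ω ψ → ∀ e : E N,
    ∫ x in Ω, u x * fderiv ℝ ψ x e = - ∫ x in Ω, inner ℝ e (G x) * ψ x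

theorem continuous_integral_mul {F : Type*} [NormedAddCommGroup F] [NormedSpace ℝ F]
    {μ : Measure (E N)} [IsFiniteMeasureOnCompacts μ] (L : F →L[ℝ] ℝ) {g : E N → ℝ}
    (hg : Continuous g) (hgc : HasCompactSupport g) :
    Continuous fun f : Lp F (ENNReal.ofReal p) μ => ∫ x, L (f x) * g x ∂μ := by
  have hc : p.HolderConjugate p.conjExponent := .conjExponent Fact.out
  have : ENNReal.HolderConjugate (ENNReal.ofReal p) (ENNReal.ofReal p.conjExponent) :=
    hc.ennrealOfReal
  have : Fact ((1 : ENNReal) ≤ ENNReal.ofReal p.conjExponent) :=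
    ⟨by simpa using ENNReal.ofReal_le_ofReal hc.symm.lt.le⟩
  have hm : MemLp g (ENNReal.ofReal p.conjExponent) μ := hg.memLp_of_hasCompactSupport hgc
  let B : F →L[ℝ] ℝ →L[ℝ] ℝ := (ContinuousLinearMap.mul ℝ ℝ).comp L
  have hB : ∀ f : Lp F (ENNReal.ofReal p) μ, ∫ x, L (f x) * g x ∂μ =
      (B.lpPairing μ (ENNReal.ofReal p) (ENNReal.ofReal p.conjExponent)).flip hm.toLp f := by
    intro f
    rw [ContinuousLinearMap.flip_apply, ContinuousLinearMap.lpPairing_eq_integral]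
    refine integral_congr_ae ?_
    filter_upwards [hm.coeFn_toLp] with x hx
    rw [hx]; rfl
  simp only [hB]
  exact ContinuousLinearMap.continuous _

theorem isWeakGradient_of_isTest {φ : E N → ℝ} (hφ : IsTest Ω φ) :
    IsWeakGradient Ω φ (gradient φ) := by
  intro ψ hψ e
  have hz : ∀ x, x ∉ Ω → φ x = 0 := fun x hx =>
    image_eq_zero_of_notMem_tsupport fun h => hx (hφ.supp h)
  have hz' : ∀ x, x ∉ Ω → ψ x = 0 := fun x hx =>
    image_eq_zero_of_notMem_tsupport fun h => hx (hψ.supp h)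
  have hin : ∀ x, inner ℝ e (gradient φ x) = fderiv ℝ φ x e := fun x => by
    rw [real_inner_comm, gradient, InnerProductSpace.toDual_symm_apply]
  simp only [hin]
  rw [setIntegral_eq_integral_of_forall_compl_eq_zero (fun x hx => by rw [hz x hx, zero_mul]),
    setIntegral_eq_integral_of_forall_compl_eq_zero (fun x hx => by rw [hz' x hx, mul_zero])]
  have c1 : Continuous φ := hφ.smooth.continuous
  have c2 : Continuous ψ := hψ.smooth.continuous
  have c3 : Continuous fun x => fderiv ℝ φ x e :=
    (hφ.smooth.continuous_fderiv (by simp)).clm_apply continuous_const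
  have c4 : Continuous fun x => fderiv ℝ ψ x e :=
    (hψ.smooth.continuous_fderiv (by simp)).clm_apply continuous_const
  exact integral_mul_fderiv_eq_neg_fderiv_mul_of_integrable
    ((c3.mul c2).integrable_of_hasCompactSupport hψ.compact.mul_left)
    ((c1.mul c4).integrable_of_hasCompactSupport hφ.compact.mul_right)
    ((c1.mul c2).integrable_of_hasCompactSupport hφ.compact.mul_right)
    (fun x _ => hφ.smooth.differentiable (by simp) x)
    (fun x _ => hψ.smooth.differentiable (by simp) x)

/-- Every test function belongs to `W^{1,p}_0(Ω)`, with its classical gradient. -/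
theorem exists_of_isTest {φ : E N → ℝ} (hφ : IsTest Ω φ) :
    ∃ u : W0 Ω p, val u =ᵐ[volume.restrict Ω] φ ∧ grad u =ᵐ[volume.restrict Ω] gradient φ := by
  have h1 : MemLp φ (ENNReal.ofReal p) (volume.restrict Ω) :=
    hφ.smooth.continuous.memLp_of_hasCompactSupport hφ.compact
  have h2 : MemLp (gradient φ) (ENNReal.ofReal p) (volume.restrict Ω) := by
    refine Continuous.memLp_of_hasCompactSupport ?_ ?_
    · exact (LinearIsometryEquiv.continuous _).comp (hφ.smooth.continuous_fderiv (by simp))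
    · exact (hφ.compact.fderiv ℝ).comp_left (map_zero _)
  exact ⟨⟨(h1.toLp, h2.toLp), Submodule.le_topologicalClosure _
    ⟨φ, hφ, h1.coeFn_toLp, h2.coeFn_toLp⟩⟩, h1.coeFn_toLp, h2.coeFn_toLp⟩

/-- The second component of an element of `W^{1,p}_0(Ω)` is the weak gradient of the first. -/
theorem isWeakGradient (u : W0 Ω p) : IsWeakGradient Ω (val u) (grad u) := by
  intro ψ hψ e
  have hcl : IsClosed {z : LpFun Ω p × LpVec Ω p |
      ∫ x in Ω, z.1 x * fderiv ℝ ψ x e = - ∫ x in Ω, inner ℝ e (z.2 x) * ψ x} := by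
    refine isClosed_eq ?_ (Continuous.neg ?_)
    · exact (continuous_integral_mul (ContinuousLinearMap.id ℝ ℝ)
        ((hψ.smooth.continuous_fderiv (by simp)).clm_apply continuous_const)
        (hψ.compact.fderiv_apply ℝ e)).comp continuous_fst
    · exact (continuous_integral_mul (innerSL ℝ e) hψ.smooth.continuous hψ.compact).comp
        continuous_snd
  refine closure_minimal ?_ hcl u.2
  rintro z ⟨φ, hφ, h1, h2⟩
  have := isWeakGradient_of_isTest hφ ψ hψ e
  change _ = _
  convert this using 1
  · exact integral_congr_ae (by filter_upwards [h1] with x hx; rw [hx])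
  · exact congrArg _ (integral_congr_ae (by filter_upwards [h2] with x hx; rw [hx]))

/-- An element of `W^{1,p}_0(Ω)` is determined by its underlying function. -/
theorem ext_val (hΩ : IsOpen Ω) {u v : W0 Ω p} (h : val u = val v) : u = v := by
  have key : ∀ z : W0 Ω p, val z = 0 → grad z = 0 := by
    intro z hz
    have hloc : ∀ e : E N, ∀ᵐ x, x ∈ Ω → inner ℝ e (grad z x) = 0 := by
      intro e
      have hi : LocallyIntegrableOn (fun x => inner ℝ e (grad z x)) Ω := by
        refine locallyIntegrableOn_of_locallyIntegrable_restrict ?_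
        have hm : MemLp (fun x => inner ℝ e (grad z x)) (ENNReal.ofReal p) (volume.restrict Ω) :=
          (Lp.memLp (grad z)).const_inner e
        exact hm.locallyIntegrable Fact.out
      refine hΩ.ae_eq_zero_of_integral_contDiff_smul_eq_zero hi fun ψ hs hc hsu => ?_
      have := isWeakGradient z ψ ⟨hs, hc, hsu⟩ e
      rw [hz] at this
      have h0 : ∫ x in Ω, (0 : LpFun Ω p) x * fderiv ℝ ψ x e = 0 := by
        refine integral_eq_zero_of_ae ?_
        filter_upwards [Lp.coeFn_zero ℝ (ENNReal.ofReal p) (volume.restrict Ω)] with x hx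
        rw [hx]; simp
      rw [h0, eq_comm, neg_eq_zero, setIntegral_eq_integral_of_forall_compl_eq_zero] at this
      · simpa only [smul_eq_mul, mul_comm] using this
      · intro x hx
        rw [image_eq_zero_of_notMem_tsupport fun h => hx (hsu h), mul_zero]
    rw [Lp.eq_zero_iff_ae_eq_zero]
    have hall : ∀ᵐ x, ∀ i : Fin N, x ∈ Ω → inner ℝ (EuclideanSpace.single i 1) (grad z x) = 0 :=
      ae_all_iff.2 fun i => hloc _
    filter_upwards [(ae_restrict_iff' hΩ.measurableSet).2
      (hall.mono fun x hx hxΩ i => hx i hxΩ)] with x hx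
    ext i
    have := hx i
    rw [EuclideanSpace.inner_single_left] at this
    simpa using this
  have hz := key (u - v) (by rw [map_sub, h, sub_self])
  refine sub_eq_zero.1 (Subtype.ext (Prod.ext ?_ hz))
  change val (u - v) = 0
  rw [map_sub, h, sub_self]

end Faithful

end PLap

end

/-!
Everything rests on the strict subgradient inequality
`|b|^p > |a|^p + p |a|^{p-2} a · (b - a)` for `a ≠ b`, a form of Young's inequality with its
equality case (`norm_rpow_add_inner_lt`).  Integrated, it gives
`p ⟨-Δ_p a, b⟩ ≤ (p - 1) I(a) + I(b)`, with equality only for `a = b`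
(`mul_negPLaplacian_le`, `eq_of_mul_negPLaplacian_eq`).

*Differentiability.*  By convexity, the first-order remainder of `f ↦ ‖f‖^p` on `L^p` at `f` lies
between `0` and `p ‖pairing g - pairing f‖ ‖g - f‖`, so it is enough that `f ↦ |f|^{p-2} f` is
continuous from `L^p` to the dual of `L^p` (`tendsto_norm_pairing_sub`, `hasFDerivAt_norm_rpow_Lp`).

*Solvability of `-Δ_p v = f`.*  The energy `Φ(v) = I(v)/p - ⟨f, v⟩` is bounded below by the Poincaré
inequality (`exists_norm_val_le`), which comes from integrating `|φ|^p = |φ|^p ∂_i x_i` by parts.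
A minimizing sequence is Cauchy, by a quantitative form of convexity
(`exists_norm_sub_rpow_le_Lp`), so no weak compactness is needed; the limit minimizes `Φ` and
therefore solves the equation (`exists_negPLaplacian_eq`).

Continuity of the duality map and quantitative convexity are both instances of one compactness
argument: if `P` and `Q ≥ 0` are continuous and `p`-homogeneous on `H × H`, and `P > 0` forces
`Q ≠ 0`, then `P ≤ ε (|a|^p + |b|^p) + C_ε Q` (`exists_le_of_homogeneous`).  This covers all
`p ∈ (1, ∞)` at once.

*The descent direction.*  Write `v = v_u`, `l = ⟨|u|^{p-2} u, v⟩ = I(v)` and `z = l u`.  Since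
`⟨-Δ_p v, u⟩ = J(u) = 1`, Young's inequality for `(v, z)` gives `l ≤ I(z)`, and for `(z, v)` it gives
`p ⟨-Δ_p z, v⟩ ≤ (p - 1) I(z) + l ≤ p I(z)`.  As `⟨I'(u), w_u⟩` is a positive multiple of
`⟨-Δ_p z, v⟩ - I(z)`, it is nonpositive, and if it vanishes then `I(z) = l`, the first inequality
is an equality, and `v = z`, that is, `w_u = 0`.  Conversely `w_u` is tangent to `S`, and `w_u = 0`
makes `-Δ_p u` a multiple of `|u|^{p-2} u`.
-/

namespace PLap

open Filter Topology

/-! ### Pointwise convexity inequalities -/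

section Pointwise

variable {p : ℝ} {H : Type*} [NormedAddCommGroup H] [InnerProductSpace ℝ H]

/-- Strict convexity of `t ↦ t ^ p`, as a tangent inequality; a rescaled Bernoulli inequality. -/
theorem rpow_add_mul_sub_lt (hp : 1 < p) {s t : ℝ} (hs : 0 < s) (ht : 0 ≤ t) (hst : s ≠ t) :
    s ^ p + p * (s ^ (p - 1) * (t - s)) < t ^ p := by
  have h1 : -1 ≤ t / s - 1 := by
    have : 0 ≤ t / s := by positivity
    linarith
  have h2 : t / s - 1 ≠ 0 := fun h => hst (by field_simp at h; linarith)
  have h := one_add_mul_self_lt_rpow_one_add h1 h2 hp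
  rw [add_sub_cancel, Real.div_rpow ht hs.le, lt_div_iff₀ (by positivity)] at h
  have h3 : s ^ p = s ^ (p - 1) * s := by rw [← Real.rpow_add_one hs.ne']; ring_nf
  calc s ^ p + p * (s ^ (p - 1) * (t - s)) = (1 + p * (t / s - 1)) * s ^ p := by
        rw [h3]; field_simp
    _ < t ^ p := h

/-- Strict subgradient inequality for `‖·‖ ^ p`: if the norms differ it is strict by convexity of
`t ↦ t ^ p`, and if they agree by the equality case of Cauchy-Schwarz. -/
theorem norm_rpow_add_inner_lt (hp : 1 < p) {a b : H} (hab : a ≠ b) :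
    ‖a‖ ^ p + p * (‖a‖ ^ (p - 2) * inner ℝ a (b - a)) < ‖b‖ ^ p := by
  have hp0 : 0 < p := one_pos.trans hp
  rcases eq_or_ne a 0 with rfl | ha
  · have : 0 < ‖b‖ := norm_pos_iff.2 hab.symm
    simp [Real.zero_rpow hp0.ne']
    positivity
  have hs : 0 < ‖a‖ := norm_pos_iff.2 ha
  have h3 : ‖a‖ ^ (p - 1) = ‖a‖ ^ (p - 2) * ‖a‖ := by
    rw [← Real.rpow_add_one hs.ne']; ring_nf
  have hc : 0 < ‖a‖ ^ (p - 2) := by positivity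
  have hin : inner ℝ a (b - a) = inner ℝ a b - ‖a‖ * ‖a‖ := by
    rw [inner_sub_right, real_inner_self_eq_norm_mul_norm]
  rcases eq_or_ne ‖a‖ ‖b‖ with h | h
  · have : inner ℝ a b < ‖a‖ * ‖b‖ := by
      rw [inner_lt_norm_mul_iff_real, ← h]
      exact fun hh => hab (smul_right_injective H hs.ne' hh)
    rw [← h] at this ⊢
    rw [hin]
    have : ‖a‖ ^ (p - 2) * (inner ℝ a b - ‖a‖ * ‖a‖) < 0 :=
      mul_neg_of_pos_of_neg hc (by linarith)
    nlinarith
  · refine lt_of_le_of_lt ?_ (rpow_add_mul_sub_lt hp hs (norm_nonneg b) h)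
    rw [h3, mul_assoc, hin]
    gcongr
    have := real_inner_le_norm a b
    linarith

theorem norm_rpow_add_inner_le (hp : 1 < p) (a b : H) :
    ‖a‖ ^ p + p * (‖a‖ ^ (p - 2) * inner ℝ a (b - a)) ≤ ‖b‖ ^ p := by
  rcases eq_or_ne a b with rfl | h
  · simp
  · exact (norm_rpow_add_inner_lt hp h).le

/-- Strict midpoint convexity of `‖·‖ ^ p`. -/
theorem norm_midpoint_rpow_lt (hp : 1 < p) {a b : H} (hab : a ≠ b) :
    ‖(1 / 2 : ℝ) • (a + b)‖ ^ p < (‖a‖ ^ p + ‖b‖ ^ p) / 2 := by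
  set m := (1 / 2 : ℝ) • (a + b) with hm
  have hma : a - m = -(b - m) := by rw [hm]; module
  have hne : m ≠ a := by
    intro h
    refine hab (sub_eq_zero.1 ?_)
    have : a - b = (2 : ℝ) • (a - m) := by rw [hm]; module
    rw [this, h, sub_self, smul_zero]
  have h1 := norm_rpow_add_inner_lt hp hne
  have h2 := norm_rpow_add_inner_le hp m b
  rw [hma, inner_neg_right] at h1
  linarith

/-- For continuous `p`-homogeneous `P`, `Q` with `Q ≥ 0` and `Q ≠ 0` wherever `P > 0`, a multiple
of `Q` bounds `P` up to an arbitrarily small multiple of `‖a‖ ^ p + ‖b‖ ^ p`.  By homogeneity it is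
enough to bound `P / Q` on the compact part of the unit sphere where `P ≥ ε`. -/
theorem exists_le_of_homogeneous [FiniteDimensional ℝ H] {P Q : H × H → ℝ}
    (hP : Continuous P) (hQ : Continuous Q)
    (hPh : ∀ t : ℝ, 0 < t → ∀ z, P (t • z) = t ^ p * P z)
    (hQh : ∀ t : ℝ, 0 < t → ∀ z, Q (t • z) = t ^ p * Q z)
    (hQ0 : ∀ z, 0 ≤ Q z) (hPQ : ∀ z, 0 < P z → Q z ≠ 0) (hP0 : P 0 ≤ 0)
    {ε : ℝ} (hε : 0 < ε) :
    ∃ C, 0 ≤ C ∧ ∀ a b, P (a, b) ≤ ε * (‖a‖ ^ p + ‖b‖ ^ p) + C * Q (a, b) := by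
  have hK : IsCompact (Metric.sphere (0 : H × H) 1 ∩ {z | ε ≤ P z}) :=
    (isCompact_sphere _ _).inter_right (isClosed_le continuous_const hP)
  have hcont : ContinuousOn (fun z => P z / Q z) (Metric.sphere (0 : H × H) 1 ∩ {z | ε ≤ P z}) :=
    hP.continuousOn.div hQ.continuousOn fun z hz => hPQ z (hε.trans_le hz.2)
  obtain ⟨C, hC⟩ := hK.bddAbove_image hcont
  refine ⟨max C 0, le_max_right _ _, fun a b => ?_⟩
  have hn : ∀ z : H × H, ‖z‖ ^ p ≤ ‖z.1‖ ^ p + ‖z.2‖ ^ p := by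
    intro z
    have h1 : 0 ≤ ‖z.1‖ ^ p := by positivity
    have h2 : 0 ≤ ‖z.2‖ ^ p := by positivity
    rcases max_choice ‖z.1‖ ‖z.2‖ with h | h <;> rw [Prod.norm_def, h] <;> linarith
  have hsph : ∀ y : H × H, ‖y‖ = 1 → P y ≤ ε + max C 0 * Q y := by
    intro y hy
    rcases lt_or_ge (P y) ε with h | h
    · have := mul_nonneg (le_max_right C 0) (hQ0 y)
      linarith
    · have hq : 0 < Q y := (hQ0 y).lt_of_ne' (hPQ y (hε.trans_le h))
      have h1 : P y / Q y ≤ max C 0 :=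
        (hC ⟨y, ⟨by simpa using hy, h⟩, rfl⟩).trans (le_max_left _ _)
      have := (div_le_iff₀ hq).1 h1
      linarith
  rcases eq_or_ne (a, b) 0 with hz | hz
  · have h2 := mul_nonneg (le_max_right C 0) (hQ0 (a, b))
    have h3 : 0 ≤ ε * (‖a‖ ^ p + ‖b‖ ^ p) := by positivity
    rw [← hz] at hP0
    linarith
  · have ht : 0 < ‖(a, b)‖ := norm_pos_iff.2 hz
    have hy := hsph (‖(a, b)‖⁻¹ • (a, b))
      (by rw [norm_smul, norm_inv, norm_norm, inv_mul_cancel₀ ht.ne'])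
    have hzy : (a, b) = ‖(a, b)‖ • (‖(a, b)‖⁻¹ • (a, b)) := (smul_inv_smul₀ ht.ne' _).symm
    have e1 := hPh _ ht (‖(a, b)‖⁻¹ • (a, b))
    have e2 := hQh _ ht (‖(a, b)‖⁻¹ • (a, b))
    rw [← hzy] at e1 e2
    rw [e1, e2]
    have h0 : 0 ≤ ‖(a, b)‖ ^ p := by positivity
    have := mul_le_mul_of_nonneg_left hy h0
    have := mul_le_mul_of_nonneg_left (hn (a, b)) hε.le
    simp only at this
    linarith

/-- The duality map `a ↦ |a|^{p-2} a`.  Its value at `0` is `0`, whatever `0 ^ (p - 2)` is. -/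
noncomputable def dualityMap (p : ℝ) (a : H) : H := ‖a‖ ^ (p - 2) • a

theorem norm_dualityMap (hp : 1 < p) (a : H) : ‖dualityMap p a‖ = ‖a‖ ^ (p - 1) := by
  rw [dualityMap, norm_smul, Real.norm_of_nonneg (by positivity)]
  rcases eq_or_ne a 0 with rfl | ha
  · rw [norm_zero, mul_zero, Real.zero_rpow (by linarith)]
  · rw [← Real.rpow_add_one (norm_ne_zero_iff.2 ha)]; ring_nf

theorem dualityMap_smul {t : ℝ} (ht : 0 < t) (a : H) :
    dualityMap p (t • a) = t ^ (p - 1) • dualityMap p a := by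
  rw [dualityMap, dualityMap, norm_smul, Real.norm_of_nonneg ht.le,
    Real.mul_rpow ht.le (norm_nonneg a), smul_smul, smul_smul]
  congr 1
  have : t ^ (p - 1) = t ^ (p - 2) * t := by rw [← Real.rpow_add_one ht.ne']; ring_nf
  rw [this]; ring

theorem continuous_dualityMap (hp : 1 < p) : Continuous (dualityMap p : H → H) := by
  rw [continuous_iff_continuousAt]
  intro a
  rcases eq_or_ne a 0 with rfl | ha
  · have h0 : dualityMap p (0 : H) = 0 := smul_zero _
    rw [ContinuousAt, h0]
    refine squeeze_zero_norm (fun a => (norm_dualityMap hp a).le) ?_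
    have : Continuous fun a : H => ‖a‖ ^ (p - 1) :=
      continuous_norm.rpow_const fun _ => Or.inr (by linarith)
    simpa [Real.zero_rpow (by linarith : p - 1 ≠ 0)] using this.tendsto 0
  · exact (continuousAt_id.norm.rpow_const (Or.inl (norm_ne_zero_iff.2 ha))).smul continuousAt_id

/-- Quantitative convexity: the midpoint convexity gap of `‖·‖ ^ p` controls `‖a - b‖ ^ p` up to
an arbitrarily small error.  It stands in for Clarkson's inequalities, without a case distinction
at `p = 2`. -/
theorem exists_norm_sub_rpow_le [FiniteDimensional ℝ H] (hp : 1 < p) {ε : ℝ} (hε : 0 < ε) :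
    ∃ C, 0 ≤ C ∧ ∀ a b : H, ‖a - b‖ ^ p ≤ ε * (‖a‖ ^ p + ‖b‖ ^ p) +
      C * ((‖a‖ ^ p + ‖b‖ ^ p) / 2 - ‖(1 / 2 : ℝ) • (a + b)‖ ^ p) := by
  have hp0 : 0 < p := one_pos.trans hp
  have hh : ∀ t : ℝ, 0 < t → ∀ a : H, ‖t • a‖ ^ p = t ^ p * ‖a‖ ^ p := fun t ht a => by
    rw [norm_smul, Real.norm_of_nonneg ht.le, Real.mul_rpow ht.le (norm_nonneg a)]
  have hc : ∀ f : H × H → H, Continuous f → Continuous fun z => ‖f z‖ ^ p := fun f hf =>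
    hf.norm.rpow_const fun _ => Or.inr hp0.le
  refine exists_le_of_homogeneous (P := fun z => ‖z.1 - z.2‖ ^ p)
    (Q := fun z => (‖z.1‖ ^ p + ‖z.2‖ ^ p) / 2 - ‖(1 / 2 : ℝ) • (z.1 + z.2)‖ ^ p)
    (hc _ (by fun_prop)) ((((hc _ continuous_fst).add (hc _ continuous_snd)).div_const 2).sub
      (hc _ (by fun_prop))) ?_ ?_ ?_ ?_ ?_ hε
  · intro t ht z
    simp only [Prod.smul_fst, Prod.smul_snd, ← smul_sub, hh t ht]
  · intro t ht z
    simp only [Prod.smul_fst, Prod.smul_snd, ← smul_add, smul_comm (1 / 2 : ℝ) t, hh t ht]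
    ring
  · intro z
    rcases eq_or_ne z.1 z.2 with h | h
    · rw [h, ← two_smul ℝ z.2, smul_smul]; norm_num
    · exact sub_nonneg.2 (norm_midpoint_rpow_lt hp h).le
  · intro z hz
    refine (sub_pos.2 (norm_midpoint_rpow_lt hp fun h => ?_)).ne'
    simp [h, Real.zero_rpow hp0.ne'] at hz
  · simp [Real.zero_rpow hp0.ne']

/-- The pointwise estimate behind continuity of `f ↦ |f|^{p-2} f` from `L^p` to `L^q`. -/
theorem exists_norm_dualityMap_sub_rpow_le [FiniteDimensional ℝ H] (hp : 1 < p) {ε : ℝ}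
    (hε : 0 < ε) :
    ∃ C, 0 ≤ C ∧ ∀ a b : H, ‖dualityMap p a - dualityMap p b‖ ^ p.conjExponent ≤
      ε * (‖a‖ ^ p + ‖b‖ ^ p) + C * ‖a - b‖ ^ p := by
  have hp0 : 0 < p := one_pos.trans hp
  have hq0 : 0 < p.conjExponent := (Real.HolderConjugate.conjExponent hp).symm.pos
  have hcd := continuous_dualityMap (H := H) hp
  refine exists_le_of_homogeneous
    (P := fun z => ‖dualityMap p z.1 - dualityMap p z.2‖ ^ p.conjExponent)
    (Q := fun z => ‖z.1 - z.2‖ ^ p)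
    (((hcd.comp continuous_fst).sub (hcd.comp continuous_snd)).norm.rpow_const
      fun _ => Or.inr hq0.le)
    ((continuous_fst.sub continuous_snd).norm.rpow_const fun _ => Or.inr hp0.le)
    ?_ ?_ (fun z => by positivity) ?_ ?_ hε
  · intro t ht z
    have : 0 ≤ t ^ (p - 1) := by positivity
    simp only [Prod.smul_fst, Prod.smul_snd, dualityMap_smul ht, ← smul_sub]
    rw [norm_smul, Real.norm_of_nonneg this, Real.mul_rpow this (norm_nonneg _),
      ← Real.rpow_mul ht.le]
    congr 2
    rw [Real.conjExponent]
    have : p - 1 ≠ 0 := by linarith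
    field_simp
  · intro t ht z
    simp only [Prod.smul_fst, Prod.smul_snd, ← smul_sub]
    rw [norm_smul, Real.norm_of_nonneg ht.le, Real.mul_rpow ht.le (norm_nonneg _)]
  · intro z hz hz'
    have : z.1 = z.2 := by
      rw [Real.rpow_eq_zero (norm_nonneg _) hp0.ne', norm_sub_eq_zero_iff] at hz'
      exact hz'
    simp [this, Real.zero_rpow hq0.ne'] at hz
  · simp [Real.zero_rpow hq0.ne']

end Pointwise

/-! ### The functional `‖f‖^p` on `L^p` and its derivative -/

section PowerIntegral

variable {N : ℕ} {p : ℝ} [hp : Fact (1 < p)] {H : Type*} [NormedAddCommGroup H]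
  {μ : Measure (E N)}

theorem integrable_norm_rpow_coe (f : Lp H (ENNReal.ofReal p) μ) :
    Integrable (fun x => ‖f x‖ ^ p) μ := by
  have hp0 : 0 < p := one_pos.trans hp.out
  have := (Lp.memLp f).integrable_norm_rpow (by simpa using hp0) (by simp)
  rwa [ENNReal.toReal_ofReal hp0.le] at this

theorem integral_norm_rpow_eq (f : Lp H (ENNReal.ofReal p) μ) :
    ∫ x, ‖f x‖ ^ p ∂μ = ‖f‖ ^ p := by
  have hp0 : 0 < p := one_pos.trans hp.out
  have h0 : 0 ≤ ∫ x, ‖f x‖ ^ p ∂μ := integral_nonneg fun x => by positivity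
  rw [Lp.norm_def, (Lp.memLp f).eLpNorm_eq_integral_rpow_norm (by simpa using hp0) (by simp),
    ENNReal.toReal_ofReal hp0.le, ENNReal.toReal_ofReal (by positivity),
    Real.rpow_inv_rpow h0 hp0.ne']

variable [InnerProductSpace ℝ H]

theorem pairing_self (f : Lp H (ENNReal.ofReal p) μ) : pairing f f = ‖f‖ ^ p := by
  rw [pairing_apply, ← integral_norm_rpow_eq]
  congr 1; ext x
  rcases eq_or_ne (f x) 0 with h | h
  · simp [h, Real.zero_rpow (one_pos.trans hp.out).ne']
  · rw [real_inner_self_eq_norm_mul_norm, ← mul_assoc, ← Real.rpow_add_one (norm_ne_zero_iff.2 h),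
      ← Real.rpow_add_one (norm_ne_zero_iff.2 h)]
    ring_nf

/-- The integral of the pointwise excess in the subgradient inequality is the excess in `L^p`. -/
theorem integral_excess_eq (f g : Lp H (ENNReal.ofReal p) μ) :
    Integrable (fun x => ‖g x‖ ^ p -
      (‖f x‖ ^ p + p * (‖f x‖ ^ (p - 2) * inner ℝ (f x) (g x - f x)))) μ ∧
    ∫ x, ‖g x‖ ^ p - (‖f x‖ ^ p + p * (‖f x‖ ^ (p - 2) * inner ℝ (f x) (g x - f x))) ∂μ =
      ‖g‖ ^ p - (‖f‖ ^ p + p * pairing f (g - f)) := by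
  have e : (fun x => ‖f x‖ ^ (p - 2) * inner ℝ (f x) ((g - f : Lp H (ENNReal.ofReal p) μ) x))
      =ᵐ[μ] fun x => ‖f x‖ ^ (p - 2) * inner ℝ (f x) (g x - f x) := by
    filter_upwards [Lp.coeFn_sub g f] with x hx
    rw [hx, Pi.sub_apply]
  have hi := ((integrable_integrand f (g - f)).congr e).const_mul p
  have hfi := integrable_norm_rpow_coe f
  have hgi := integrable_norm_rpow_coe g
  have hsum : Integrable (fun x => ‖f x‖ ^ p +
      p * (‖f x‖ ^ (p - 2) * inner ℝ (f x) (g x - f x))) μ := hfi.add hi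
  refine ⟨hgi.sub hsum, ?_⟩
  rw [integral_sub hgi hsum, integral_add hfi hi, integral_const_mul,
    integral_norm_rpow_eq, integral_norm_rpow_eq, pairing_apply, integral_congr_ae e]

theorem norm_rpow_add_pairing_le (f g : Lp H (ENNReal.ofReal p) μ) :
    ‖f‖ ^ p + p * pairing f (g - f) ≤ ‖g‖ ^ p := by
  rw [← sub_nonneg, ← (integral_excess_eq f g).2]
  exact integral_nonneg fun x => sub_nonneg.2 (norm_rpow_add_inner_le hp.out _ _)

/-- Equality case of the subgradient inequality in `L^p`: the pointwise excess is nonnegative, so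
it vanishes almost everywhere. -/
theorem eq_of_norm_rpow_add_pairing_eq {f g : Lp H (ENNReal.ofReal p) μ}
    (h : ‖f‖ ^ p + p * pairing f (g - f) = ‖g‖ ^ p) : f = g := by
  obtain ⟨hi, he⟩ := integral_excess_eq f g
  rw [h, sub_self, integral_eq_zero_iff_of_nonneg
    (fun x => sub_nonneg.2 (norm_rpow_add_inner_le hp.out _ _)) hi] at he
  refine Lp.ext ?_
  filter_upwards [he] with x hx
  by_contra hne
  exact (sub_pos.2 (norm_rpow_add_inner_lt hp.out hne)).ne' hx

/-- Hölder's inequality for the difference of two duality functionals. -/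
theorem norm_pairing_sub_le (f g : Lp H (ENNReal.ofReal p) μ) :
    ‖pairing g - pairing f‖ ≤
      (∫ x, ‖dualityMap p (g x) - dualityMap p (f x)‖ ^ p.conjExponent ∂μ)
        ^ (1 / p.conjExponent) := by
  have hc : p.HolderConjugate p.conjExponent := .conjExponent hp.out
  have hp0 : 0 < p := hc.pos
  have : ENNReal.HolderConjugate (ENNReal.ofReal p.conjExponent) (ENNReal.ofReal p) :=
    hc.symm.ennrealOfReal
  have hmem : ∀ f : Lp H (ENNReal.ofReal p) μ,
      MemLp (fun x => dualityMap p (f x)) (ENNReal.ofReal p.conjExponent) μ := fun f =>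
    (memLp_norm_rpow_sub_one f).of_le
      ((continuous_dualityMap hp.out).comp_aestronglyMeasurable (Lp.memLp f).1)
      (.of_forall fun x => by
        rw [norm_dualityMap hp.out, Real.norm_of_nonneg (by positivity)])
  have hd := (hmem g).sub (hmem f)
  refine ContinuousLinearMap.opNorm_le_bound _ (by positivity) fun h => ?_
  have hh := integral_mul_norm_le_Lp_mul_Lq hc.symm hd (Lp.memLp h)
  have hi : Integrable (fun x => ‖dualityMap p (g x) - dualityMap p (f x)‖ * ‖h x‖) μ :=
    MemLp.integrable_mul hd.norm (Lp.memLp h).norm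
  have hn : ‖h‖ = (∫ x, ‖h x‖ ^ p ∂μ) ^ (1 / p) := by
    rw [integral_norm_rpow_eq, one_div, Real.rpow_rpow_inv (norm_nonneg h) hp0.ne']
  rw [hn, sub_apply, pairing_apply, pairing_apply,
    ← integral_sub (integrable_integrand g h) (integrable_integrand f h)]
  refine (norm_integral_le_of_norm_le hi (.of_forall fun x => ?_)).trans hh
  rw [← real_inner_smul_left, ← real_inner_smul_left, ← inner_sub_left]
  exact norm_inner_le_norm _ _

/-- Continuity of the duality map from `L^p` to its dual. -/
theorem tendsto_norm_pairing_sub [FiniteDimensional ℝ H] (f : Lp H (ENNReal.ofReal p) μ) :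
    Tendsto (fun g => ‖pairing g - pairing f‖) (𝓝 f) (𝓝 0) := by
  have hp0 : 0 < p := one_pos.trans hp.out
  have hq0 : 0 < p.conjExponent := (Real.HolderConjugate.conjExponent hp.out).symm.pos
  set X : Lp H (ENNReal.ofReal p) μ → ℝ := fun g =>
    ∫ x, ‖dualityMap p (g x) - dualityMap p (f x)‖ ^ p.conjExponent ∂μ with hX
  have hX0 : ∀ g, 0 ≤ X g := fun g => integral_nonneg fun x => by positivity
  have hlim : Tendsto X (𝓝 f) (𝓝 0) := by
    refine tendsto_order.2 ⟨fun η hη => .of_forall fun g => hη.trans_le (hX0 g), fun η hη => ?_⟩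
    -- The weight `η / (2 (2 ‖f‖^p + 1))` keeps the first error term below `η` for `g` near `f`.
    have hA : 0 < 2 * (2 * ‖f‖ ^ p + 1) := by positivity
    obtain ⟨C, hC0, hC⟩ := exists_norm_dualityMap_sub_rpow_le (H := H) hp.out (div_pos hη hA)
    have hle : ∀ g, X g ≤ η / (2 * (2 * ‖f‖ ^ p + 1)) * (‖g‖ ^ p + ‖f‖ ^ p) +
        C * ‖g - f‖ ^ p := by
      intro g
      have e : (fun x => ‖(g - f : Lp H (ENNReal.ofReal p) μ) x‖ ^ p) =ᵐ[μ]
          fun x => ‖g x - f x‖ ^ p := by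
        filter_upwards [Lp.coeFn_sub g f] with x hx
        rw [hx, Pi.sub_apply]
      have hgi := integrable_norm_rpow_coe g
      have hfi := integrable_norm_rpow_coe f
      have hdi := (integrable_norm_rpow_coe (g - f)).congr e
      have hsum : Integrable (fun x => ‖g x‖ ^ p + ‖f x‖ ^ p) μ := hgi.add hfi
      refine (integral_mono_of_nonneg (.of_forall fun x => by positivity)
        ((hsum.const_mul _).add (hdi.const_mul C)) (.of_forall fun x => hC _ _)).trans_eq ?_
      simp only [Pi.add_apply]
      rw [integral_add (hsum.const_mul _) (hdi.const_mul _), integral_const_mul,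
        integral_const_mul, integral_add hgi hfi, ← integral_congr_ae e, integral_norm_rpow_eq,
        integral_norm_rpow_eq, integral_norm_rpow_eq]
    have hcont : Continuous fun g : Lp H (ENNReal.ofReal p) μ =>
        η / (2 * (2 * ‖f‖ ^ p + 1)) * (‖g‖ ^ p + ‖f‖ ^ p) + C * ‖g - f‖ ^ p := by
      have h1 : Continuous fun g : Lp H (ENNReal.ofReal p) μ => ‖g‖ ^ p :=
        continuous_norm.rpow_const fun _ => Or.inr hp0.le
      have h2 : Continuous fun g : Lp H (ENNReal.ofReal p) μ => ‖g - f‖ ^ p :=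
        (continuous_id.sub continuous_const).norm.rpow_const fun _ => Or.inr hp0.le
      fun_prop
    have hlt : η / (2 * (2 * ‖f‖ ^ p + 1)) * (‖f‖ ^ p + ‖f‖ ^ p) + C * ‖f - f‖ ^ p < η := by
      rw [sub_self, norm_zero, Real.zero_rpow hp0.ne', mul_zero, add_zero, div_mul_eq_mul_div,
        div_lt_iff₀ hA]
      have : 0 ≤ ‖f‖ ^ p := by positivity
      nlinarith
    filter_upwards [hcont.continuousAt.eventually_lt_const hlt] with g hg
    exact (hle g).trans_lt hg
  have hlim' : Tendsto (fun g => X g ^ (1 / p.conjExponent)) (𝓝 f) (𝓝 0) := by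
    have := hlim.rpow_const (p := 1 / p.conjExponent) (Or.inr (by positivity))
    rwa [Real.zero_rpow (by positivity)] at this
  exact squeeze_zero (fun g => ContinuousLinearMap.opNorm_nonneg _)
    (fun g => norm_pairing_sub_le f g) hlim'

/-- The subgradient inequalities at `f` and at `g` trap the remainder between `0` and
`p * ‖pairing g - pairing f‖ * ‖g - f‖`. -/
theorem hasFDerivAt_norm_rpow_Lp [FiniteDimensional ℝ H] (f : Lp H (ENNReal.ofReal p) μ) :
    HasFDerivAt (fun g : Lp H (ENNReal.ofReal p) μ => ‖g‖ ^ p) (p • pairing f) f := by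
  have hp0 : 0 < p := one_pos.trans hp.out
  rw [hasFDerivAt_iff_isLittleO, Asymptotics.isLittleO_iff]
  intro c hc
  have hcont : Tendsto (fun g : Lp H (ENNReal.ofReal p) μ => p * ‖pairing g - pairing f‖)
      (𝓝 f) (𝓝 0) := by
    simpa using (tendsto_norm_pairing_sub f).const_mul p
  filter_upwards [hcont.eventually_lt_const hc] with g hg
  have h1 := norm_rpow_add_pairing_le f g
  have h2 := norm_rpow_add_pairing_le g f
  rw [← neg_sub g f, map_neg] at h2
  have h3 : pairing g (g - f) - pairing f (g - f) ≤ ‖pairing g - pairing f‖ * ‖g - f‖ :=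
    (le_abs_self _).trans ((pairing g - pairing f).le_opNorm (g - f))
  have h4 := mul_le_mul_of_nonneg_left h3 hp0.le
  have h5 := mul_le_mul_of_nonneg_right hg.le (norm_nonneg (g - f))
  rw [smul_apply, smul_eq_mul, Real.norm_of_nonneg (by linarith)]
  linarith

end PowerIntegral

/-! ### The Poincaré inequality -/

section Poincare

variable {N : ℕ} {Ω : Set (E N)} {p : ℝ}

/-- Integration by parts of `|φ|^p = |φ|^p ∂_i x_i`. -/
theorem integral_norm_rpow_eq_neg_integral_coord_mul (hp : 1 < p) (i : Fin N) {φ : E N → ℝ}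
    (hφ : IsTest Ω φ) :
    ∫ x, ‖φ x‖ ^ p =
      -∫ x, x i * (p * (‖φ x‖ ^ (p - 2) * φ x * fderiv ℝ φ x (EuclideanSpace.single i 1))) := by
  have hp0 : 0 < p := one_pos.trans hp
  have h1 : ContDiff ℝ 1 fun x => ‖φ x‖ ^ p := (hφ.smooth.of_le (by simp)).norm_rpow hp
  have h1c : HasCompactSupport fun x => ‖φ x‖ ^ p :=
    hφ.compact.comp_left (g := fun t : ℝ => ‖t‖ ^ p) (by simp [Real.zero_rpow hp0.ne'])
  have hl : ∀ x, fderiv ℝ (fun y : E N => y i) x (EuclideanSpace.single i 1) = 1 := fun x => by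
    have : (fun y : E N => y i) = EuclideanSpace.proj (𝕜 := ℝ) i := rfl
    rw [this, ContinuousLinearMap.fderiv]
    simp
  have hld : Differentiable ℝ fun y : E N => y i :=
    (EuclideanSpace.proj (𝕜 := ℝ) i).differentiable
  have hcoord : Continuous fun y : E N => y i := hld.continuous
  have hf : ∀ x, fderiv ℝ (fun x => ‖φ x‖ ^ p) x (EuclideanSpace.single i 1) =
      p * (‖φ x‖ ^ (p - 2) * φ x * fderiv ℝ φ x (EuclideanSpace.single i 1)) := fun x => by
    have := (hasFDerivAt_norm_rpow (φ x) hp).comp x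
      (hφ.smooth.differentiable (by simp) x).hasFDerivAt
    rw [HasFDerivAt.fderiv (f := fun x => ‖φ x‖ ^ p) this]
    simp
    ring
  have key := integral_mul_fderiv_eq_neg_fderiv_mul_of_integrable (μ := volume)
    (f := fun y : E N => y i) (g := fun x => ‖φ x‖ ^ p) (v := EuclideanSpace.single i (1 : ℝ))
    ?_ ?_ ?_ (fun x _ => hld x) (fun x _ => h1.differentiable (by simp) x)
  · simp only [hl, one_mul, hf] at key
    rw [key, neg_neg]
  · simp only [hl, one_mul]
    exact h1.continuous.integrable_of_hasCompactSupport h1c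
  · exact (hcoord.mul ((h1.continuous_fderiv (by simp)).clm_apply
      continuous_const)).integrable_of_hasCompactSupport (h1c.fderiv_apply ℝ _).mul_left
  · exact (hcoord.mul h1.continuous).integrable_of_hasCompactSupport h1c.mul_left

/-- Young's inequality for the exponents `p / (p - 1)` and `p`. -/
theorem mul_rpow_sub_one_mul_le (hp : 1 < p) {s t : ℝ} (hs : 0 ≤ s) (ht : 0 ≤ t) :
    p * (s ^ (p - 1) * t) ≤ (p - 1) * s ^ p + t ^ p := by
  have hp0 : 0 < p := one_pos.trans hp
  have h := norm_rpow_add_inner_le hp s t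
  simp only [Real.norm_of_nonneg hs, Real.norm_of_nonneg ht, RCLike.inner_apply, conj_trivial] at h
  rcases hs.eq_or_lt with rfl | hs
  · simp only [Real.zero_rpow hp0.ne', Real.zero_rpow (by linarith : p - 1 ≠ 0)]
    have : 0 ≤ t ^ p := by positivity
    linarith
  have h3 : s ^ (p - 1) = s ^ (p - 2) * s := by rw [← Real.rpow_add_one hs.ne']; ring_nf
  have h4 : s ^ p = s ^ (p - 1) * s := by rw [← Real.rpow_add_one hs.ne']; ring_nf
  rw [h3] at h4 ⊢
  nlinarith

/-- Poincaré inequality for test functions: Young's inequality with the factor `p * R` put on the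
gradient lets the `|φ|^p` term be absorbed. -/
theorem integral_norm_rpow_le_of_isTest (hp : 1 < p) (i : Fin N) {R : ℝ}
    (hR : ∀ x ∈ Ω, ‖x‖ ≤ R) (hR0 : 0 ≤ R) {φ : E N → ℝ} (hφ : IsTest Ω φ) :
    ∫ x in Ω, ‖φ x‖ ^ p ≤ (p * R) ^ p * ∫ x in Ω, ‖gradient φ x‖ ^ p := by
  have hp0 : 0 < p := one_pos.trans hp
  have hz : ∀ x, x ∉ tsupport φ → φ x = 0 := fun x => image_eq_zero_of_notMem_tsupport
  have hgz : ∀ x, x ∉ tsupport φ → gradient φ x = 0 := fun x hx => by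
    have : fderiv ℝ φ x = 0 := by
      by_contra h
      exact hx (support_fderiv_subset ℝ h)
    rw [gradient, this, map_zero]
  rw [setIntegral_eq_integral_of_forall_compl_eq_zero (fun x hx => by
      rw [hz x fun h => hx (hφ.supp h), norm_zero, Real.zero_rpow hp0.ne']),
    setIntegral_eq_integral_of_forall_compl_eq_zero (fun x hx => by
      rw [hgz x fun h => hx (hφ.supp h), norm_zero, Real.zero_rpow hp0.ne'])]
  have hgc : Continuous (gradient φ) :=
    (LinearIsometryEquiv.continuous _).comp (hφ.smooth.continuous_fderiv (by simp))
  have hi1 : Integrable fun x => ‖φ x‖ ^ p :=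
    (hφ.smooth.continuous.norm.rpow_const fun _ => Or.inr hp0.le).integrable_of_hasCompactSupport
      (hφ.compact.comp_left (g := fun t : ℝ => ‖t‖ ^ p) (by simp [Real.zero_rpow hp0.ne']))
  have hi2 : Integrable fun x => ‖gradient φ x‖ ^ p :=
    (hgc.norm.rpow_const fun _ => Or.inr hp0.le).integrable_of_hasCompactSupport
      ((hφ.compact.fderiv ℝ).comp_left
        (g := fun L => ‖(InnerProductSpace.toDual ℝ (E N)).symm L‖ ^ p)
        (by simp [Real.zero_rpow hp0.ne']))
  have hpt : ∀ x, ‖x i * (p * (‖φ x‖ ^ (p - 2) * φ x *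
      fderiv ℝ φ x (EuclideanSpace.single i 1)))‖ ≤
      (1 - 1 / p) * ‖φ x‖ ^ p + (1 / p) * ((p * R) ^ p * ‖gradient φ x‖ ^ p) := by
    intro x
    by_cases hx : x ∈ tsupport φ
    swap
    · simp [hz x hx, hgz x hx, Real.zero_rpow hp0.ne']
    have hxi : ‖x i‖ ≤ R := (PiLp.norm_apply_le x i).trans (hR x (hφ.supp hx))
    have hd : ‖fderiv ℝ φ x (EuclideanSpace.single i 1)‖ ≤ ‖gradient φ x‖ := by
      refine ((fderiv ℝ φ x).le_opNorm _).trans_eq ?_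
      rw [gradient, LinearIsometryEquiv.norm_map]
      simp
    have hφx : ‖‖φ x‖ ^ (p - 2) * φ x‖ = ‖φ x‖ ^ (p - 1) := norm_dualityMap hp (φ x)
    have hy := mul_rpow_sub_one_mul_le hp (norm_nonneg (φ x))
      (by positivity : 0 ≤ p * R * ‖gradient φ x‖)
    rw [Real.mul_rpow (by positivity) (norm_nonneg _)] at hy
    calc _ = ‖x i‖ * (p * (‖φ x‖ ^ (p - 1) * ‖fderiv ℝ φ x (EuclideanSpace.single i 1)‖)) := by
          rw [norm_mul, norm_mul, norm_mul, hφx, Real.norm_of_nonneg hp0.le]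
      _ ≤ R * (p * (‖φ x‖ ^ (p - 1) * ‖gradient φ x‖)) := by gcongr
      _ = (1 / p) * (p * (‖φ x‖ ^ (p - 1) * (p * R * ‖gradient φ x‖))) := by field_simp
      _ ≤ (1 / p) * ((p - 1) * ‖φ x‖ ^ p + (p * R) ^ p * ‖gradient φ x‖ ^ p) := by gcongr
      _ = _ := by field_simp
  have hint := (norm_integral_le_of_norm_le ((hi1.const_mul _).add ((hi2.const_mul _).const_mul _))
    (.of_forall hpt))
  have hle := (neg_le_abs _).trans hint
  rw [← integral_norm_rpow_eq_neg_integral_coord_mul hp i hφ] at hle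
  simp only [Pi.add_apply] at hle
  rw [integral_add (hi1.const_mul _) ((hi2.const_mul _).const_mul _), integral_const_mul,
    integral_const_mul, integral_const_mul] at hle
  have h2 : 1 / p * ∫ x, ‖φ x‖ ^ p ≤ 1 / p * ((p * R) ^ p * ∫ x, ‖gradient φ x‖ ^ p) := by
    linarith
  exact le_of_mul_le_mul_left h2 (by positivity)

/-- Poincaré inequality on `W^{1,p}_0(Ω)`, by closure from test functions. -/
theorem exists_norm_val_le [Fact (1 < p)] (hN : 0 < N) (hΩb : Bornology.IsBounded Ω) :
    ∃ C, 0 ≤ C ∧ ∀ u : W0 Ω p, ‖val u‖ ≤ C * ‖grad u‖ := by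
  have hp : 1 < p := Fact.out
  have hp0 : 0 < p := one_pos.trans hp
  obtain ⟨R, hR0, hR⟩ := hΩb.exists_pos_norm_le
  refine ⟨p * R, by positivity, fun u => ?_⟩
  have hcl : IsClosed {z : LpFun Ω p × LpVec Ω p | ‖z.1‖ ≤ p * R * ‖z.2‖} :=
    isClosed_le continuous_fst.norm (continuous_const.mul continuous_snd.norm)
  refine closure_minimal ?_ hcl u.2
  rintro z ⟨φ, hφ, h1, h2⟩
  have h := integral_norm_rpow_le_of_isTest hp ⟨0, hN⟩ hR hR0.le hφ
  have e1 : ∫ x in Ω, ‖φ x‖ ^ p = ‖z.1‖ ^ p := by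
    rw [← integral_norm_rpow_eq]
    exact integral_congr_ae (by filter_upwards [h1] with x hx; rw [hx])
  have e2 : ∫ x in Ω, ‖gradient φ x‖ ^ p = ‖z.2‖ ^ p := by
    rw [← integral_norm_rpow_eq]
    exact integral_congr_ae (by filter_upwards [h2] with x hx; rw [hx])
  rw [e1, e2, ← Real.mul_rpow (by positivity) (norm_nonneg _)] at h
  exact (Real.rpow_le_rpow_iff (norm_nonneg _) (by positivity) hp0).1 h

end Poincare

/-! ### The Dirichlet problem for the p-Laplacian -/

section DirectMethod

/-- Quantitative convexity of `‖f‖^p` on `L^p`. -/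
theorem exists_norm_sub_rpow_le_Lp {N : ℕ} {p : ℝ} [hp : Fact (1 < p)] {H : Type*}
    [NormedAddCommGroup H] [InnerProductSpace ℝ H] [FiniteDimensional ℝ H] {μ : Measure (E N)}
    {ε : ℝ} (hε : 0 < ε) :
    ∃ C, 0 ≤ C ∧ ∀ f g : Lp H (ENNReal.ofReal p) μ, ‖f - g‖ ^ p ≤ ε * (‖f‖ ^ p + ‖g‖ ^ p) +
      C * ((‖f‖ ^ p + ‖g‖ ^ p) / 2 - ‖(1 / 2 : ℝ) • (f + g)‖ ^ p) := by
  obtain ⟨C, hC0, hC⟩ := exists_norm_sub_rpow_le (H := H) hp.out hε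
  refine ⟨C, hC0, fun f g => ?_⟩
  have hfi := integrable_norm_rpow_coe f
  have hgi := integrable_norm_rpow_coe g
  have hmi := integrable_norm_rpow_coe ((1 / 2 : ℝ) • (f + g))
  have hsum : Integrable (fun x => ‖f x‖ ^ p + ‖g x‖ ^ p) μ := hfi.add hgi
  have hgap : Integrable (fun x => (‖f x‖ ^ p + ‖g x‖ ^ p) / 2 -
      ‖((1 / 2 : ℝ) • (f + g) : Lp H (ENNReal.ofReal p) μ) x‖ ^ p) μ :=
    (hsum.div_const 2).sub hmi
  rw [← integral_norm_rpow_eq (f - g)]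
  refine (integral_mono_ae (integrable_norm_rpow_coe (f - g))
    ((hsum.const_mul ε).add (hgap.const_mul C)) ?_).trans_eq ?_
  · filter_upwards [Lp.coeFn_sub f g, Lp.coeFn_smul (1 / 2 : ℝ) (f + g), Lp.coeFn_add f g]
      with x h1 h2 h3
    simp only [Pi.add_apply]
    rw [h1, h2, Pi.smul_apply, h3]
    exact hC _ _
  · simp only [Pi.add_apply]
    rw [integral_add (hsum.const_mul _) (hgap.const_mul _), integral_const_mul,
      integral_const_mul, integral_sub (hsum.div_const 2) hmi, integral_div,
      integral_add hfi hgi, integral_norm_rpow_eq, integral_norm_rpow_eq, integral_norm_rpow_eq]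

variable {N : ℕ} {Ω : Set (E N)} {p : ℝ} [hp : Fact (1 < p)]

theorem I_eq (u : W0 Ω p) : I u = ‖grad u‖ ^ p := integral_norm_rpow_eq _

theorem J_eq (u : W0 Ω p) : J u = ‖val u‖ ^ p := integral_norm_rpow_eq (val u)

theorem negPLaplacian_self (u : W0 Ω p) : negPLaplacian u u = I u := by
  rw [I_eq]; exact pairing_self _

theorem powFunctional_self (u : W0 Ω p) : powFunctional u u = J u := by
  rw [J_eq]; exact pairing_self _

theorem hasFDerivAt_I (u : W0 Ω p) : HasFDerivAt I (p • negPLaplacian u) u := by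
  have : (I : W0 Ω p → ℝ) = (fun f => ‖f‖ ^ p) ∘ grad := funext I_eq
  rw [this]
  exact (hasFDerivAt_norm_rpow_Lp (grad u)).comp u grad.hasFDerivAt

theorem hasFDerivAt_J (u : W0 Ω p) : HasFDerivAt J (p • powFunctional u) u := by
  have : (J : W0 Ω p → ℝ) = (fun f => ‖f‖ ^ p) ∘ val := funext J_eq
  rw [this]
  exact (hasFDerivAt_norm_rpow_Lp (val u)).comp u val.hasFDerivAt

/-- Young's inequality for the pairing with the p-Laplacian. -/
theorem mul_negPLaplacian_le (a b : W0 Ω p) :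
    p * negPLaplacian a b ≤ (p - 1) * I a + I b := by
  have h := norm_rpow_add_pairing_le (grad a) (grad b)
  rw [map_sub, pairing_self, ← I_eq, ← I_eq] at h
  change I a + p * (negPLaplacian a b - I a) ≤ I b at h
  linarith

theorem grad_injective (hN : 0 < N) (hΩb : Bornology.IsBounded Ω) :
    Function.Injective (grad : W0 Ω p → LpVec Ω p) := by
  obtain ⟨C, hC0, hC⟩ := exists_norm_val_le (p := p) hN hΩb
  rw [injective_iff_map_eq_zero]
  intro z hz
  have h := hC z
  rw [hz, norm_zero, mul_zero, norm_le_zero_iff] at h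
  exact Subtype.ext (Prod.ext h hz)

theorem eq_of_mul_negPLaplacian_eq (hN : 0 < N) (hΩb : Bornology.IsBounded Ω) {a b : W0 Ω p}
    (h : p * negPLaplacian a b = (p - 1) * I a + I b) : a = b := by
  refine grad_injective hN hΩb (eq_of_norm_rpow_add_pairing_eq ?_)
  rw [map_sub, pairing_self, ← I_eq, ← I_eq]
  change I a + p * (negPLaplacian a b - I a) = I b
  linarith

/-- If `-Δ_p a = -Δ_p b`, Young's inequality in both orders gives `I a = I b`, and its equality case
gives `a = b`. -/
theorem negPLaplacian_injective (hN : 0 < N) (hΩb : Bornology.IsBounded Ω) :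
    Function.Injective (negPLaplacian : W0 Ω p → _) := by
  have key : ∀ a b : W0 Ω p, negPLaplacian a = negPLaplacian b →
      p * negPLaplacian a b = p * I b := fun a b h => by rw [h, negPLaplacian_self]
  intro a b hab
  have hp0 : 0 < p - 1 := sub_pos.2 hp.out
  have h1 := mul_negPLaplacian_le a b
  have h2 := mul_negPLaplacian_le b a
  rw [key a b hab] at h1
  rw [key b a hab.symm] at h2
  have h3 : I a = I b := le_antisymm (by nlinarith) (by nlinarith)
  refine eq_of_mul_negPLaplacian_eq hN hΩb ?_
  rw [key a b hab, h3]
  ring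

/-- `-Δ_p` is onto the dual of `W^{1,p}_0(Ω)`: minimizing sequences of
`v ↦ I v / p - f v` converge strongly. -/
theorem exists_negPLaplacian_eq (hN : 0 < N) (hΩb : Bornology.IsBounded Ω)
    (f : W0 Ω p →L[ℝ] ℝ) : ∃ v, negPLaplacian v = f := by
  have hp1 : 0 < p - 1 := sub_pos.2 hp.out
  have hp0 : 0 < p := one_pos.trans hp.out
  have hcompl : CompleteSpace (W0 Ω p) :=
    (Submodule.isClosed_topologicalClosure _).completeSpace_coe
  obtain ⟨C₀, -, hC₀⟩ := exists_norm_val_le (p := p) hN hΩb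
  set K := max C₀ 1 with hKdef
  have hK0 : 0 < K := one_pos.trans_le (le_max_right _ _)
  have hK : ∀ v : W0 Ω p, ‖v‖ ≤ K * ‖grad v‖ := fun v =>
    max_le ((hC₀ v).trans (by gcongr; exact le_max_left _ _))
      (le_mul_of_one_le_left (norm_nonneg _) (le_max_right _ _))
  set Φ : W0 Ω p → ℝ := fun v => I v / p - f v with hΦ
  have hΦd : ∀ v, HasFDerivAt Φ (p⁻¹ • (p • negPLaplacian v) - f) v := fun v => by
    have := ((hasFDerivAt_I v).const_mul p⁻¹).sub f.hasFDerivAt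
    refine this.congr_of_eventuallyEq (.of_forall fun w => ?_)
    simp only [hΦ, Pi.sub_apply]
    ring
  have hΦc : Continuous Φ := continuous_iff_continuousAt.2 fun v => (hΦd v).continuousAt
  -- Coercivity: `s` is chosen with `s ^ (p - 1) = 2c`, so Young leaves half of `I v / p`.
  obtain ⟨M, hM⟩ : ∃ M, ∀ v, I v ≤ 2 * p * (Φ v + M) := by
    set c := ‖f‖ * K with hc
    have hc0 : 0 ≤ c := mul_nonneg (norm_nonneg f) hK0.le
    set s := (2 * c) ^ (p - 1)⁻¹ with hs
    have hs0 : 0 ≤ s := by positivity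
    refine ⟨(p - 1) * s ^ p / (2 * p), fun v => ?_⟩
    have h1 := mul_rpow_sub_one_mul_le hp.out hs0 (norm_nonneg (grad v))
    rw [hs, Real.rpow_inv_rpow (by positivity) hp1.ne', ← hs, ← I_eq] at h1
    have h2 : f v ≤ c * ‖grad v‖ := by
      refine (le_abs_self _).trans ((f.le_opNorm v).trans ?_)
      rw [hc, mul_assoc]
      exact mul_le_mul_of_nonneg_left (hK v) (norm_nonneg f)
    have h3 : p * f v ≤ p * (c * ‖grad v‖) := by gcongr
    have e : 2 * p * (Φ v + (p - 1) * s ^ p / (2 * p)) =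
        2 * I v - 2 * (p * f v) + (p - 1) * s ^ p := by
      simp only [hΦ]; field_simp
    rw [e]
    linarith
  have hI0 : ∀ v : W0 Ω p, 0 ≤ I v := fun v => integral_nonneg fun x => by positivity
  have hbdd : BddBelow (range Φ) := by
    refine ⟨-M, ?_⟩
    rintro _ ⟨v, rfl⟩
    have h : 0 ≤ Φ v + M := nonneg_of_mul_nonneg_right ((hI0 v).trans (hM v)) (by positivity)
    linarith
  set m := ⨅ v, Φ v with hm
  have hmle : ∀ v, m ≤ Φ v := fun v => ciInf_le hbdd v
  have hex : ∀ n : ℕ, ∃ v, Φ v < m + 1 / ((n : ℝ) + 1) := fun n =>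
    exists_lt_of_ciInf_lt (lt_add_of_pos_right _ (by positivity))
  choose v hv using hex
  have hone : ∀ n : ℕ, 1 / ((n : ℝ) + 1) ≤ 1 := fun n => by
    rw [div_le_one (by positivity)]
    have : (0 : ℝ) ≤ n := n.cast_nonneg
    linarith
  set B := 2 * p * (m + 1 + M) with hB
  have hIB : ∀ n, I (v n) ≤ B := fun n => (hM _).trans (by
    rw [hB]; have := hv n; have := hone n; gcongr; linarith)
  have hB0 : 0 ≤ B := (hI0 _).trans (hIB 0)
  have hcauchy : CauchySeq v := by
    rw [Metric.cauchySeq_iff']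
    intro η hη
    set δ := (η / K) ^ p with hδ
    have hδ0 : 0 < δ := by positivity
    -- `I (v n) ≤ B`, so this `ε` contributes at most `δ / 2`; the convexity gap, bounded by
    -- `p / (n + 1)` along the sequence, contributes the other half.
    obtain ⟨C, hC0, hC⟩ := exists_norm_sub_rpow_le_Lp (N := N) (p := p) (H := E N)
      (μ := volume.restrict Ω) (ε := δ / (4 * (B + 1))) (by positivity)
    have hlim : Tendsto (fun n : ℕ => C * (p * (1 / ((n : ℝ) + 1)))) atTop (𝓝 0) := by
      have := (tendsto_one_div_add_atTop_nhds_zero_nat (𝕜 := ℝ)).const_mul p |>.const_mul C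
      simpa only [mul_zero] using this
    obtain ⟨n, hn⟩ := (hlim.eventually_lt_const (half_pos hδ0)).exists
    refine ⟨n, fun k hk => ?_⟩
    have h := hC (grad (v k)) (grad (v n))
    rw [← map_sub, ← map_add, ← map_smul, ← I_eq (v k), ← I_eq (v n),
      ← I_eq ((1 / 2 : ℝ) • (v k + v n))] at h
    have hgap : (I (v k) + I (v n)) / 2 - I ((1 / 2 : ℝ) • (v k + v n)) ≤
        p * (1 / ((n : ℝ) + 1)) := by
      have e : (I (v k) + I (v n)) / 2 - I ((1 / 2 : ℝ) • (v k + v n)) =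
          p * ((Φ (v k) + Φ (v n)) / 2 - Φ ((1 / 2 : ℝ) • (v k + v n))) := by
        simp only [hΦ, map_smul, map_add, smul_eq_mul]
        field_simp
        ring
      rw [e]
      have h1 := hmle ((1 / 2 : ℝ) • (v k + v n))
      have h2 := hv k
      have h3 := hv n
      have h4 : 1 / ((k : ℝ) + 1) ≤ 1 / ((n : ℝ) + 1) := by gcongr
      gcongr
      linarith
    have h1 : δ / (4 * (B + 1)) * (I (v k) + I (v n)) ≤ δ / 2 := by
      rw [div_mul_eq_mul_div, div_le_iff₀ (by positivity)]
      have := hIB k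
      have := hIB n
      nlinarith
    have h2 := mul_le_mul_of_nonneg_left hgap hC0
    have h3 : ‖grad (v k - v n)‖ ^ p < (η / K) ^ p := by linarith
    rw [Real.rpow_lt_rpow_iff (norm_nonneg _) (by positivity) hp0, lt_div_iff₀ hK0] at h3
    rw [dist_eq_norm]
    linarith [hK (v k - v n)]
  obtain ⟨w, hw⟩ := cauchySeq_tendsto_of_complete hcauchy
  have hwm : Φ w ≤ m := by
    have h1 := (hΦc.tendsto w).comp hw
    have h2 : Tendsto (fun n : ℕ => m + 1 / ((n : ℝ) + 1)) atTop (𝓝 m) := by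
      simpa using (tendsto_one_div_add_atTop_nhds_zero_nat (𝕜 := ℝ)).const_add m
    exact le_of_tendsto_of_tendsto' h1 h2 fun n => (hv n).le
  have hmin : IsLocalMin Φ w := .of_forall fun z => hwm.trans (hmle z)
  refine ⟨w, ?_⟩
  have h0 := hmin.hasFDerivAt_eq_zero (hΦd w)
  rwa [smul_smul, inv_mul_cancel₀ hp0.ne', one_smul, sub_eq_zero] at h0

theorem negPLaplacian_smul {c : ℝ} (hc : 0 < c) (u : W0 Ω p) :
    negPLaplacian (c • u) = c ^ (p - 1) • negPLaplacian u := by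
  ext φ
  rw [smul_apply, negPLaplacian_apply, negPLaplacian_apply, smul_eq_mul, ← integral_const_mul]
  refine integral_congr_ae ?_
  filter_upwards [Lp.coeFn_smul c (grad u)] with x hx
  rw [map_smul, hx, Pi.smul_apply, ← real_inner_smul_left, ← real_inner_smul_left]
  change inner ℝ (dualityMap p (c • grad u x)) _ = c ^ (p - 1) * inner ℝ (dualityMap p _) _
  rw [dualityMap_smul hc, real_inner_smul_left]

theorem I_smul {c : ℝ} (hc : 0 < c) (u : W0 Ω p) : I (c • u) = c ^ p * I u := by
  rw [I_eq, I_eq, map_smul, norm_smul, Real.norm_of_nonneg hc.le,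
    Real.mul_rpow hc.le (norm_nonneg _)]

end DirectMethod

end PLap

/-! ### The descent direction -/

theorem lemma2 {N : ℕ} (hN : 0 < N) (Ω : Set (EuclideanSpace ℝ (Fin N))) (hΩ : IsOpen Ω)
    (hΩb : Bornology.IsBounded Ω) (p : ℝ) [Fact (1 < p)]
    (u : PLap.W0 Ω p) (hu : u ∈ PLap.S Ω p) :
    -- the objects in the claim are well defined
    (DifferentiableAt ℝ PLap.I u ∧ DifferentiableAt ℝ PLap.J u) ∧
    (∃! v : PLap.W0 Ω p, PLap.negPLaplacian v = PLap.powFunctional u) ∧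
    0 < ∫ x in Ω, |PLap.val u x| ^ (p - 2) * PLap.val u x * PLap.val (PLap.vdir u) x ∧
    -- the claim
    fderiv ℝ PLap.I u (PLap.wdir u) ≤ 0 ∧
    (fderiv ℝ PLap.I u (PLap.wdir u) = 0 ↔ PLap.IsCriticalOnS u) ∧
    (PLap.IsCriticalOnS u ↔ PLap.wdir u = 0) := by
  open PLap in
  have hp : 1 < p := Fact.out
  have hp0 : 0 < p := one_pos.trans hp
  have hJu : J u = 1 := hu
  have hA : negPLaplacian (vdir u) = powFunctional u :=
    Function.invFun_eq (exists_negPLaplacian_eq hN hΩb (powFunctional u))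
  set v := vdir u with hv
  set l := powFunctional u v with hl
  have hlI : l = I v := by rw [hl, ← hA, negPLaplacian_self]
  have hAu : negPLaplacian v u = 1 := by rw [hA, powFunctional_self, hJu]
  have hl0 : 0 < l := by
    have hI0 : 0 ≤ I v := integral_nonneg fun x => by positivity
    refine (hlI ▸ hI0).lt_of_ne' fun h0 => ?_
    -- If `I v = 0`, then `v` minimizes `I`, so `-Δ_p v = 0`, although `⟨-Δ_p v, u⟩ = J u = 1`.
    have hmin : IsLocalMin I v :=
      .of_forall fun z => (hlI.symm.trans h0).trans_le (integral_nonneg fun x => by positivity)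
    have h := DFunLike.congr_fun (hmin.hasFDerivAt_eq_zero (hasFDerivAt_I v)) u
    rw [smul_apply, hAu] at h
    simp [hp0.ne'] at h
  have hw : wdir u = -u + (1 / l) • v := by rw [wdir, ← powFunctional_apply]
  have hI' : fderiv ℝ I u = p • negPLaplacian u := (hasFDerivAt_I u).fderiv
  have hJ' : fderiv ℝ J u = p • powFunctional u := (hasFDerivAt_J u).fderiv
  set z := l • u with hz
  -- Young's inequality for `(v, z)` says `l ≤ I z`, as `⟨-Δ_p v, z⟩ = l`.
  have hvz : p * l ≤ (p - 1) * l + I z := by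
    have := mul_negPLaplacian_le v z
    rwa [hz, map_smul, hAu, smul_eq_mul, mul_one, ← hlI] at this
  have hzv : p * negPLaplacian z v ≤ (p - 1) * I z + l := by
    have := mul_negPLaplacian_le z v
    rwa [← hlI] at this
  have hIw : fderiv ℝ I u (wdir u) = p * (l ^ p)⁻¹ * (negPLaplacian z v - I z) := by
    have e : l ^ p = l ^ (p - 1) * l := by rw [← Real.rpow_add_one hl0.ne']; ring_nf
    have : l ^ (p - 1) ≠ 0 := by positivity
    rw [hI', hw, hz, negPLaplacian_smul hl0, I_smul hl0, smul_apply, smul_apply, map_add, map_neg,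
      map_smul, negPLaplacian_self, smul_eq_mul, smul_eq_mul, smul_eq_mul, e]
    field_simp
    ring
  have hle : fderiv ℝ I u (wdir u) ≤ 0 := by
    rw [hIw]
    refine mul_nonpos_of_nonneg_of_nonpos (by positivity) ?_
    nlinarith
  have hw0 : fderiv ℝ I u (wdir u) = 0 → wdir u = 0 := by
    intro h
    rw [hIw, mul_eq_zero_iff_left (by positivity), sub_eq_zero] at h
    rw [h] at hzv
    have hIz : I z = l := by linarith
    have hzeq : v = z := by
      refine eq_of_mul_negPLaplacian_eq hN hΩb ?_
      rw [hIz, ← hlI, hz, map_smul, hAu, smul_eq_mul]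
      ring
    rw [hw, hzeq, hz, smul_smul, one_div, inv_mul_cancel₀ hl0.ne', one_smul, neg_add_cancel]
  have hcrit : wdir u = 0 → IsCriticalOnS u := by
    intro h
    refine ⟨hu, fun φ hφ => ?_⟩
    have huv : u = (1 / l) • v := by
      rw [hw] at h
      exact (neg_add_eq_zero.1 h)
    have hφ0 : powFunctional u φ = 0 := by
      have : fderiv ℝ J u φ = 0 := hφ
      rw [hJ', smul_apply, smul_eq_mul] at this
      exact (mul_eq_zero.1 this).resolve_left hp0.ne'
    have hAuφ : negPLaplacian u = (1 / l) ^ (p - 1) • negPLaplacian v := by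
      conv_lhs => rw [huv]
      exact negPLaplacian_smul (by positivity) v
    rw [hI', hAuφ, hA, smul_apply, smul_apply, hφ0, smul_zero, smul_zero]
  -- `w_u` is itself tangent to `S`.
  have hcrit' : IsCriticalOnS u → fderiv ℝ I u (wdir u) = 0 := by
    intro h
    refine h.2 _ ?_
    change fderiv ℝ J u (wdir u) = 0
    rw [hJ', hw, smul_apply, map_add, map_neg, map_smul, powFunctional_self, hJu, ← hl,
      smul_eq_mul (1 / l), one_div, inv_mul_cancel₀ hl0.ne', neg_add_cancel, smul_zero]
  refine ⟨⟨(hasFDerivAt_I u).differentiableAt, (hasFDerivAt_J u).differentiableAt⟩,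
    ⟨v, hA, fun v' hv' => negPLaplacian_injective hN hΩb (hv'.trans hA.symm)⟩, ?_, hle,
    ⟨fun h => hcrit (hw0 h), hcrit'⟩, ⟨fun h => hw0 (hcrit' h), hcrit⟩⟩
  rw [← powFunctional_apply]
  exact hl0
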